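/- Let $\delta>0$ be a real number and let $r:\mathbb{N}\to\mathbb{N}$ be a function with $r(n)>1$ for all $n$ and $r(n)\in o(\log^* n)$ (for instance a constant $r>1$), where $\log^*$ is the iterated logarithm. In a graph $G=(V,E)$, a set $M\subseteq V$ is a distance-$r$ dominating set if every vertex is at distance at most $r$ from some vertex of $M$. Then there is no deterministic algorithm in the LOCAL model of distributed computing (synchronous rounds, unbounded local computation, unbounded messages between neighbors, unique identifiers) that, on every sufficiently long cycle, with $n$ denoting its number of vertices, and for every assignment of unique identifiers, halts in $O(r(n))$ rounds and outputs a distance-$r(n)$ dominating set whose size is at most $2r(n)+1-\delta$ times the minimum size of a distance-$r(n)$ dominating set of the cycle. This holds even if all vertices know $n$ and their neighbors' identifiers from the start, and the identifiers are promised to be the numbers $0,\dots,n-1$. -/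

import Mathlib

open Filter Asymptotics

universe u v w

/-- The iterated logarithm `log* n`: the least number of times that the base-two logarithm has to
be applied, starting from `n`, to reach a value that is at most `1`. -/
noncomputable def logStar (n : ℕ) : ℕ :=
  sInf {k : ℕ | (Real.logb 2)^[k] (n : ℝ) ≤ 1}

section Domination

variable {V : Type w}

/-- The closed distance-`r` neighborhood `N^r[v]`. -/
def distNbhd (G : SimpleGraph V) (r : ℕ) (v : V) : Set V :=
  {x | G.edist x v ≤ (r : ℕ∞)}

/-- `M` is a distance-`r` dominating set of `G`: the sets `N^r[v]`, `v ∈ M`, cover `V`. -/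
def IsDistDominating (G : SimpleGraph V) (r : ℕ) (M : Set V) : Prop :=
  (⋃ v ∈ M, distNbhd G r v) = Set.univ

/-- `M` is a minimum distance-`r` dominating set of the finite graph `G`. -/
def IsMinDistDominating (G : SimpleGraph V) (r : ℕ) (M : Set V) : Prop :=
  IsDistDominating G r M ∧ ∀ M' : Set V, IsDistDominating G r M' → M.ncard ≤ M'.ncard

/-- `D` is an `α`-approximation of a minimum distance-`r` dominating set of the finite
graph `G`. -/
def IsApproxDistDominating (G : SimpleGraph V) (r : ℕ) (α : ℝ) (D : Set V) : Prop :=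
  IsDistDominating G r D ∧
    ∀ M : Set V, IsMinDistDominating G r M → (D.ncard : ℝ) ≤ α * (M.ncard : ℝ)

end Domination

/-- A deterministic algorithm in the LOCAL model that selects a set of vertices. Local computation
and message sizes are unrestricted, and identifiers are natural numbers.
* `start n i S` is the initial state of a vertex with identifier `i` whose neighbors have the
  identifiers in `S`, in a network with `n` vertices;
* `send s j` is the message that a vertex in state `s` sends to its neighbor with identifier `j`;
* `receive s I` is the new state of a vertex in state `s` that has received the messages in `I`;
  a pair `(j, m)` in `I` is the message `m` sent by the neighbor with identifier `j`;
* `output s` is `none` if a vertex in state `s` continues, and `some b` if it halts with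
  output `b` (`true` if it belongs to the selected set, `false` if it does not). -/
structure LocalAlgorithm where
  State : Type u
  Msg : Type v
  start : ℕ → ℕ → Set ℕ → State
  send : State → ℕ → Msg
  receive : State → Set (ℕ × Msg) → State
  output : State → Option Bool

namespace LocalAlgorithm

variable {V : Type w} (A : LocalAlgorithm.{u, v})

/-- A vertex in state `s` has halted. -/
def Halted (s : A.State) : Prop := (A.output s).isSome = true

/-- The messages that vertex `x` receives in a round that begins with the states `σ`. Halted
vertices do not send anything. -/
def inbox (G : SimpleGraph V) (ident : V → ℕ) (σ : V → A.State) (x : V) : Set (ℕ × A.Msg) :=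
  {p | ∃ y, G.Adj x y ∧ ¬ A.Halted (σ y) ∧ p = (ident y, A.send (σ y) (ident x))}

open Classical in
/-- One synchronous round. Halted vertices keep their final state. -/
noncomputable def round (G : SimpleGraph V) (ident : V → ℕ) (σ : V → A.State) : V → A.State :=
  fun x => if A.Halted (σ x) then σ x else A.receive (σ x) (A.inbox G ident σ x)

/-- The states of the vertices after `t` rounds. -/
noncomputable def stateAfter (G : SimpleGraph V) (ident : V → ℕ) : ℕ → V → A.State
  | 0 => fun x => A.start (Nat.card V) (ident x) (ident '' G.neighborSet x)
  | t + 1 => A.round G ident (stateAfter G ident t)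

/-- Every vertex halts within at most `t` rounds. -/
def HaltsWithin (G : SimpleGraph V) (ident : V → ℕ) (t : ℕ) : Prop :=
  ∀ x, A.Halted (A.stateAfter G ident t x)

/-- The set of vertices that have halted with output `true` within `t` rounds. -/
def selected (G : SimpleGraph V) (ident : V → ℕ) (t : ℕ) : Set V :=
  {x | A.output (A.stateAfter G ident t x) = some true}

/-- On the graph `G` with identifiers `ident`, the algorithm halts within `t` rounds and its output
is an `α`-approximation of a minimum distance-`r` dominating set. -/
def FindsApproxDistDominating (G : SimpleGraph V) (ident : V → ℕ) (t r : ℕ) (α : ℝ) : Prop :=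
  A.HaltsWithin G ident t ∧ IsApproxDistDominating G r α (A.selected G ident t)

end LocalAlgorithm

/-! After `t` rounds, the output of a vertex depends only on the `2t + 3` identifiers within
distance `t + 1`, because neighbors' identifiers are known from the start. Hence windows of
identifiers are of two kinds, selected or not. By a Ramsey theorem for monotone paths
(`exists_isRun`), every set of more than `B` identifiers, `B` a tower of height about `2t`, contains
an increasing sequence with `m` consecutive selected windows or `2r + 1` consecutive unselected
ones. The latter would leave a vertex undominated.

So disjoint runs of `m` selected windows can be extracted until at most `B` identifiers remain. Laid
out one after another on the cycle, they force a fraction `m / (m + 2t + 2)` of the covered vertices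
to be selected, while about `n / (2r + 1)` vertices suffice. With `m` a large multiple of `2t + 2`,
ratio `2r + 1 - δ` is possible only if `n` is at most about `B`, so `log* n = O(t + r) = O(r)`,
contrary to `r = o(log* n)`. -/

/-! ### Towers and the iterated logarithm -/

/-- The tower `2 ^ 2 ^ ⋯ ^ 2 ^ q` with `j` twos. -/
def expTower (j q : ℕ) : ℕ := (fun x => 2 ^ x)^[j] q

theorem expTower_zero (q : ℕ) : expTower 0 q = q := rfl

theorem expTower_succ (j q : ℕ) : expTower (j + 1) q = 2 ^ expTower j q :=
  Function.iterate_succ_apply' _ _ _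

theorem expTower_succ' (j q : ℕ) : expTower (j + 1) q = expTower j (2 ^ q) :=
  Function.iterate_succ_apply _ _ _

theorem expTower_add (i j q : ℕ) : expTower (i + j) q = expTower i (expTower j q) :=
  Function.iterate_add_apply _ _ _ _

theorem expTower_mono (j : ℕ) : Monotone (expTower j) :=
  Monotone.iterate (fun _ _ h => Nat.pow_le_pow_right two_pos h) j

theorem le_expTower (j q : ℕ) : q ≤ expTower j q := by
  induction j with
  | zero => exact le_rfl
  | succ j ih => rw [expTower_succ]; exact ih.trans Nat.lt_two_pow_self.le

theorem le_expTower_one (j : ℕ) : j ≤ expTower j 1 := by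
  induction j with
  | zero => simp
  | succ j ih => rw [expTower_succ]; exact ih.trans_lt Nat.lt_two_pow_self

/-- The bound is `k ≤ j`, not `k = j`: iterating past a value at most `1` can reach negative
numbers, where `Real.logb` takes the absolute value and may exceed `1` again. -/
theorem exists_iterate_logb_le_one (j : ℕ) (x : ℝ) (hx : x ≤ (expTower j 1 : ℕ)) :
    ∃ k ≤ j, (Real.logb 2)^[k] x ≤ 1 := by
  induction j generalizing x with
  | zero => exact ⟨0, le_rfl, by simpa [expTower_zero] using hx⟩
  | succ j ih =>
    by_cases h1 : x ≤ 1
    · exact ⟨0, Nat.zero_le _, h1⟩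
    · obtain ⟨k, hk, h⟩ := ih (Real.logb 2 x) (by
        rw [Real.logb_le_iff_le_rpow one_lt_two (by linarith), Real.rpow_natCast]
        rw [expTower_succ] at hx
        exact_mod_cast hx)
      exact ⟨k + 1, by omega, h⟩

theorem logStar_le {n j : ℕ} (h : n ≤ expTower j 1) : logStar n ≤ j := by
  obtain ⟨k, hk, h⟩ := exists_iterate_logb_le_one j n (by exact_mod_cast h)
  exact (Nat.sInf_le h).trans hk

/-! ### Shift colourings and monotone Ramsey runs -/

/-- A colouring of the increasing lists of length `K + 1` in `S` such that consecutive windows have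
different colours. -/
def IsShiftColoring {α : Type*} (S : Finset ℕ) (K : ℕ) (c : List ℕ → α) : Prop :=
  ∀ l : List ℕ, l.IsChain (· < ·) → (∀ e ∈ l, e ∈ S) → l.length = K + 2 → c l.dropLast ≠ c l.tail

/-- Recolouring a list by the set of colours of its left extensions shortens lists by one and
exponentiates the number of colours. If `l.dropLast` and `l.tail` got the same set, the colour of
`l` would also be that of some `z :: l.dropLast`, and `z :: l` would violate the original colouring.
-/
theorem IsShiftColoring.card_le {S : Finset ℕ} {K : ℕ} {α : Type*} [Fintype α] {c : List ℕ → α}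
    (hc : IsShiftColoring S K c) : S.card ≤ expTower K (Fintype.card α) := by
  classical
  induction K generalizing α with
  | zero =>
    refine Finset.card_le_card_of_injOn (t := Finset.univ) (fun x => c [x]) (by simp) ?_
    intro x hx y hy h
    by_contra hne
    rcases lt_or_gt_of_ne hne with hlt | hlt
    · exact hc [x, y] (by simpa using hlt) (by simp_all) rfl h
    · exact hc [y, x] (by simpa using hlt) (by simp_all) rfl h.symm
  | succ K ih =>
    have := ih (α := Set α)
      (c := fun l => {q | ∃ x ∈ S, (x :: l).IsChain (· < ·) ∧ c (x :: l) = q}) ?_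
    · rwa [Fintype.card_set, ← expTower_succ'] at this
    · intro l hl hS hlen heq
      obtain ⟨x, y, t, rfl⟩ : ∃ x y t, l = x :: y :: t := by
        match l, hlen with
        | x :: y :: t, _ => exact ⟨x, y, t, rfl⟩
      have hmem : c (x :: y :: t) ∈ {q | ∃ z ∈ S, (z :: (x :: y :: t).dropLast).IsChain (· < ·) ∧
          c (z :: (x :: y :: t).dropLast) = q} := by
        simp only [] at heq
        rw [heq]
        exact ⟨x, hS x (by simp), hl, rfl⟩
      obtain ⟨z, hz, hch, hcz⟩ := hmem
      refine hc (z :: x :: y :: t) ?_ ?_ (by simpa using hlen) hcz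
      · rw [List.dropLast_cons_cons, List.isChain_cons_cons] at hch
        exact List.isChain_cons_cons.2 ⟨hch.1, hl⟩
      · intro e he
        rcases List.mem_cons.1 he with rfl | he
        · exact hz
        · exact hS e he

/-- The increasing list `w` in `S` consists of `m` consecutive windows of length `k + 1`, all of
which satisfy `P`. -/
structure IsRun (S : Finset ℕ) (k : ℕ) (P : List ℕ → Prop) (m : ℕ) (w : List ℕ) : Prop where
  isChain : w.IsChain (· < ·)
  mem : ∀ e ∈ w, e ∈ S
  length_eq : w.length = m + k
  window : ∀ i < m, P ((w.drop i).take (k + 1))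

theorem IsRun.nodup {S : Finset ℕ} {k m : ℕ} {P : List ℕ → Prop} {w : List ℕ}
    (h : IsRun S k P m w) : w.Nodup :=
  (List.isChain_iff_pairwise.1 h.isChain).imp ne_of_lt

open Classical in
/-- The largest number, at most `N`, of windows in a run that starts with `u`. -/
noncomputable def longestRun (S : Finset ℕ) (k : ℕ) (P : List ℕ → Prop) (N : ℕ) (u : List ℕ) : ℕ :=
  Nat.findGreatest (fun m => ∃ w, IsRun S k P m w ∧ w.take k = u) N

/-- Prepending the head of `l` to a longest run from `l.tail` adds the window `l`. The cap `N` does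
not interfere, since no run reaches it. -/
theorem longestRun_tail_lt {S : Finset ℕ} {k N : ℕ} {P : List ℕ → Prop}
    (hN : ∀ w, ¬ IsRun S (k + 1) P N w) {l : List ℕ} (hl : l.IsChain (· < ·))
    (hS : ∀ e ∈ l, e ∈ S) (hlen : l.length = k + 2) (hP : P l) :
    longestRun S (k + 1) P N l.tail < longestRun S (k + 1) P N l.dropLast := by
  classical
  obtain ⟨x, y, t, rfl⟩ : ∃ x y t, l = x :: y :: t := by
    match l, hlen with
    | x :: y :: t, _ => exact ⟨x, y, t, rfl⟩
  simp only [List.length_cons, Nat.add_right_cancel_iff] at hlen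
  rw [List.isChain_cons_cons] at hl
  rw [List.tail_cons]
  obtain ⟨w, hw, hwu⟩ := Nat.findGreatest_spec
    (P := fun m => ∃ w, IsRun S (k + 1) P m w ∧ w.take (k + 1) = y :: t) (Nat.zero_le N)
    ⟨y :: t, ⟨hl.2, fun e he => hS e (List.mem_cons_of_mem _ he), by simp [hlen], by simp⟩,
      by simp [List.take_of_length_le, hlen]⟩
  change IsRun S (k + 1) P (longestRun S (k + 1) P N (y :: t)) w at hw
  have hle : longestRun S (k + 1) P N (y :: t) ≤ N := Nat.findGreatest_le N
  have hlt : longestRun S (k + 1) P N (y :: t) < N := by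
    refine lt_of_le_of_ne hle fun h => hN w ?_
    rwa [h] at hw
  refine Nat.lt_of_succ_le (Nat.le_findGreatest hlt ⟨x :: w, ⟨?_, ?_, ?_, ?_⟩, ?_⟩)
  · match w, hwu with
    | z :: w, hwu =>
      simp only [List.take_succ_cons, List.cons.injEq] at hwu
      exact List.isChain_cons_cons.2 ⟨hwu.1 ▸ hl.1, hw.isChain⟩
  · intro e he
    rcases List.mem_cons.1 he with rfl | he
    · exact hS e (by simp)
    · exact hw.mem e he
  · simp [hw.length_eq]; omega
  · rintro (_ | i) hi
    · simpa [hwu] using hP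
    · simpa using hw.window i (Nat.lt_of_succ_lt_succ hi)
  · have : w.take k = (y :: t).dropLast := by
      rw [List.dropLast_eq_take, List.length_cons, hlen, ← hwu, List.take_take]
      simp
    simp [this]

/-- The ordered Ramsey theorem for monotone paths: a large set contains a run of `M` windows with
the property `P` or a run of `N` windows without it. -/
theorem exists_isRun {S : Finset ℕ} {k M N : ℕ} {P : List ℕ → Prop}
    (hS : expTower k ((M + 1) * (N + 1)) < S.card)
    (hN : ∀ w, ¬ IsRun S (k + 1) (fun l => ¬ P l) N w) : ∃ w, IsRun S (k + 1) P M w := by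
  classical
  by_contra! hM
  refine hS.not_ge ?_
  -- The pair of longest run lengths, with and without `P`, is a shift colouring: whichever holds of
  -- `l`, one coordinate drops.
  have := IsShiftColoring.card_le (S := S) (K := k) (α := Fin (M + 1) × Fin (N + 1))
    (c := fun l => (⟨longestRun S (k + 1) P M l, Nat.lt_succ_of_le (Nat.findGreatest_le M)⟩,
      ⟨longestRun S (k + 1) (fun l => ¬ P l) N l, Nat.lt_succ_of_le (Nat.findGreatest_le N)⟩)) ?_
  · simpa using this
  · intro l hl hlS hlen heq
    simp only [Prod.mk.injEq, Fin.mk.injEq] at heq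
    by_cases hP : P l
    · exact (longestRun_tail_lt hM hl hlS hlen hP).ne' heq.1
    · exact (longestRun_tail_lt hN hl hlS hlen hP).ne' heq.2

/-- If every large subset of `S` contains a run, then disjoint runs exhaust `S` up to few
elements. -/
theorem exists_concat_runs {S : Finset ℕ} {k m B : ℕ} {P : List ℕ → Prop} (hm : 0 < m)
    (h : ∀ S' ⊆ S, B < S'.card → ∃ w, IsRun S' k P m w) :
    ∃ (b : ℕ) (l : List ℕ), l.Nodup ∧ (∀ e ∈ l, e ∈ S) ∧ l.length = b * (m + k) ∧
      S.card ≤ B + b * (m + k) ∧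
      ∀ j < b, ∀ i < m, P ((l.drop (j * (m + k) + i)).take (k + 1)) := by
  classical
  induction S using Finset.strongInduction with
  | H S ih =>
    by_cases hB : S.card ≤ B
    · exact ⟨0, [], by simp, by simp, by simp, by simpa using hB, by simp⟩
    · obtain ⟨w, hw⟩ := h S subset_rfl (by omega)
      have hwS : w.toFinset ⊆ S := fun e he => hw.mem e (List.mem_toFinset.1 he)
      have hcard : w.toFinset.card = m + k := by
        rw [List.toFinset_card_of_nodup hw.nodup, hw.length_eq]
      obtain ⟨b, l, hnd, hl, hlen, hS, hP⟩ := ih (S \ w.toFinset)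
        (Finset.sdiff_ssubset hwS (Finset.card_pos.1 (by omega)))
        fun S' hS' => h S' (hS'.trans Finset.sdiff_subset)
      refine ⟨b + 1, w ++ l, ?_, ?_, ?_, ?_, ?_⟩
      · refine hw.nodup.append hnd fun e he he' => ?_
        have := hl e he'
        simp [he] at this
      · intro e he
        rcases List.mem_append.1 he with he | he
        · exact hw.mem e he
        · exact Finset.sdiff_subset (hl e he)
      · rw [List.length_append, hw.length_eq, hlen]; ring
      · have := Finset.card_sdiff_add_card_eq_card hwS
        rw [hcard] at this
        have e : (b + 1) * (m + k) = b * (m + k) + (m + k) := by ring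
        omega
      · rintro (_ | j) hj i hi
        · rw [Nat.zero_mul, Nat.zero_add, List.drop_append_of_le_length (by
            have := hw.length_eq
            omega), List.take_append_of_le_length (by simp [hw.length_eq]; omega)]
          exact hw.window i hi
        · have e : (j + 1) * (m + k) + i = w.length + (j * (m + k) + i) := by
            rw [hw.length_eq]; ring
          rw [e, List.drop_length_add_append]
          exact hP j (by omega) i hi

/-! ### The cycle as a path away from the seam between `n - 1` and `0` -/

theorem fin_val_sub_eq_one_iff {n : ℕ} (hn : 1 < n) (x y : Fin n) :
    (x - y).val = 1 ↔ x.val = y.val + 1 ∨ x.val + n = y.val + 1 := by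
  rcases le_or_gt y x with h | h
  · rw [Fin.coe_sub_iff_le.2 h]
    have := Fin.le_def.1 h
    omega
  · rw [Fin.coe_sub_iff_lt.2 h]
    have := Fin.lt_def.1 h
    omega

theorem cycleGraph_adj_iff_of_interior {n : ℕ} {x y : Fin n} (h0 : 0 < x.val)
    (hn : x.val + 1 < n) :
    (SimpleGraph.cycleGraph n).Adj x y ↔ y.val = x.val + 1 ∨ y.val + 1 = x.val := by
  rw [SimpleGraph.cycleGraph_adj', fin_val_sub_eq_one_iff (by omega),
    fin_val_sub_eq_one_iff (by omega)]
  omega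

theorem cycleGraph_adj_of_val_eq {n : ℕ} {x y : Fin n} (h : y.val = x.val + 1) :
    (SimpleGraph.cycleGraph n).Adj x y := by
  rw [SimpleGraph.cycleGraph_adj', fin_val_sub_eq_one_iff (by omega),
    fin_val_sub_eq_one_iff (by omega)]
  omega

theorem cycleGraph_exists_adj_translate {n : ℕ} {x x' y : Fin n} (h0 : 0 < x.val)
    (hn : x.val + 1 < n) (h0' : 0 < x'.val) (hn' : x'.val + 1 < n)
    (hy : (SimpleGraph.cycleGraph n).Adj x y) :
    ∃ y' : Fin n, (SimpleGraph.cycleGraph n).Adj x' y' ∧ y.val + x'.val = y'.val + x.val ∧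
      y.val ≤ x.val + 1 ∧ x.val ≤ y.val + 1 := by
  have := (cycleGraph_adj_iff_of_interior h0 hn).1 hy
  refine ⟨⟨y.val + x'.val - x.val, by omega⟩, ?_, ?_, by omega, by omega⟩
  · rw [cycleGraph_adj_iff_of_interior h0' hn']
    dsimp only
    omega
  · dsimp only
    omega

theorem cycleGraph_edist_le_of_val_eq {n : ℕ} (d : ℕ) {x y : Fin n} (h : y.val = x.val + d) :
    (SimpleGraph.cycleGraph n).edist x y ≤ d := by
  induction d generalizing y with
  | zero =>
    obtain rfl : y = x := Fin.ext h
    simp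
  | succ d ih =>
    have hz := ih (y := ⟨x.val + d, by omega⟩) rfl
    have hadj := cycleGraph_adj_of_val_eq (x := ⟨x.val + d, by omega⟩) (y := y) h
    calc _ ≤ _ := SimpleGraph.edist_triangle (v := ⟨x.val + d, by omega⟩)
      _ ≤ (d : ℕ∞) + 1 := add_le_add hz (SimpleGraph.edist_eq_one_iff_adj.2 hadj).le
      _ = _ := by push_cast; rfl

theorem cycleGraph_walk_val_bound {n : ℕ} {x y : Fin n}
    (p : (SimpleGraph.cycleGraph n).Walk x y) (h0 : p.length ≤ x.val)
    (hn : x.val + p.length < n) : x.val ≤ y.val + p.length ∧ y.val ≤ x.val + p.length := by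
  induction p with
  | nil => simp
  | cons h p ih =>
    rw [SimpleGraph.Walk.length_cons] at h0 hn ⊢
    have := (cycleGraph_adj_iff_of_interior (by omega) (by omega)).1 h
    have := ih (by omega) (by omega)
    omega

theorem cycleGraph_val_bound_of_edist_le {n r : ℕ} {x y : Fin n}
    (h : (SimpleGraph.cycleGraph n).edist x y ≤ r) (h0 : r ≤ x.val) (hn : x.val + r < n) :
    x.val ≤ y.val + r ∧ y.val ≤ x.val + r := by
  obtain ⟨p, hp⟩ := SimpleGraph.exists_walk_of_edist_ne_top
    (ne_top_of_le_ne_top (ENat.natCast_ne_top r) h)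
  have hpr : p.length ≤ r := by rw [← hp] at h; exact_mod_cast h
  have := cycleGraph_walk_val_bound p (by omega) (by omega)
  omega

theorem exists_isDistDominating_cycleGraph {n : ℕ} (hn : 0 < n) (r : ℕ) :
    ∃ M : Set (Fin n), IsDistDominating (SimpleGraph.cycleGraph n) r M ∧
      M.ncard ≤ n / (2 * r + 1) + 1 := by
  -- Centres of consecutive blocks of length `2r + 1`; the last centre is clamped into the cycle.
  let g : ℕ → Fin n := fun i => ⟨min (i * (2 * r + 1) + r) (n - 1), by omega⟩
  refine ⟨g '' (Finset.range (n / (2 * r + 1) + 1) : Set ℕ), ?_, ?_⟩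
  · refine Set.eq_univ_of_forall fun x => Set.mem_iUnion₂.2
      ⟨g (x.val / (2 * r + 1)), Set.mem_image_of_mem _ ?_, ?_⟩
    · rw [Finset.mem_coe, Finset.mem_range, Nat.lt_succ_iff]
      exact Nat.div_le_div_right x.isLt.le
    · have hx := x.isLt
      have h1 := Nat.div_add_mod x.val (2 * r + 1)
      have h2 := Nat.mod_lt x.val (show 0 < 2 * r + 1 by omega)
      have hg : (g (x.val / (2 * r + 1))).val =
        min (x.val / (2 * r + 1) * (2 * r + 1) + r) (n - 1) := rfl
      rw [mul_comm] at h1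
      change (SimpleGraph.cycleGraph n).edist x _ ≤ _
      rcases le_total x.val (g (x.val / (2 * r + 1))).val with h | h
      · obtain ⟨d, hd⟩ := Nat.exists_eq_add_of_le h
        refine (cycleGraph_edist_le_of_val_eq d hd).trans ?_
        exact_mod_cast (by omega : d ≤ r)
      · obtain ⟨d, hd⟩ := Nat.exists_eq_add_of_le h
        rw [SimpleGraph.edist_comm]
        refine (cycleGraph_edist_le_of_val_eq d hd).trans ?_
        exact_mod_cast (by omega : d ≤ r)
  · refine (Set.ncard_image_le (Finset.finite_toSet _)).trans ?_
    rw [Set.ncard_coe_finset, Finset.card_range]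

/-- The optimum `c` is kept in the bound because `α` may be negative, so it cannot be replaced by
`M.ncard`. -/
theorem IsApproxDistDominating.ncard_le {V : Type*} {G : SimpleGraph V} {r : ℕ}
    {α : ℝ} {D M : Set V} (h : IsApproxDistDominating G r α D) (hM : IsDistDominating G r M) :
    ∃ c ≤ M.ncard, (D.ncard : ℝ) ≤ α * c := by
  classical
  have hex : ∃ c, ∃ M, IsDistDominating G r M ∧ M.ncard = c := ⟨_, M, hM, rfl⟩
  obtain ⟨M', hM', hc⟩ := Nat.find_spec hex
  refine ⟨M'.ncard, hc ▸ Nat.find_min' hex ⟨M, hM, rfl⟩, h.2 M' ⟨hM', fun M'' h'' => ?_⟩⟩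
  exact hc ▸ Nat.find_min' hex ⟨M'', h'', rfl⟩

/-! ### Locality of the algorithm -/

namespace LocalAlgorithm

variable (A : LocalAlgorithm.{u, v})

theorem stateAfter_cycleGraph_congr {n : ℕ} {ident ident' : Fin n → ℕ} (t : ℕ) {x x' : Fin n}
    (hx : t + 1 ≤ x.val) (hxn : x.val + (t + 1) < n) (hx' : t + 1 ≤ x'.val)
    (hxn' : x'.val + (t + 1) < n)
    (h : ∀ y y' : Fin n, y.val + x'.val = y'.val + x.val → y.val ≤ x.val + (t + 1) →
      x.val ≤ y.val + (t + 1) → ident y = ident' y') :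
    A.stateAfter (SimpleGraph.cycleGraph n) ident t x =
      A.stateAfter (SimpleGraph.cycleGraph n) ident' t x' := by
  induction t generalizing x x' with
  | zero =>
    have hid : ident x = ident' x' := h x x' (by omega) (by omega) (by omega)
    have hnb : ident '' (SimpleGraph.cycleGraph n).neighborSet x =
        ident' '' (SimpleGraph.cycleGraph n).neighborSet x' := by
      ext e
      constructor
      · rintro ⟨y, hy, rfl⟩
        obtain ⟨y', hy', h1, h2, h3⟩ := cycleGraph_exists_adj_translate (x' := x')
          (by omega) (by omega) (by omega) (by omega) hy
        exact ⟨y', hy', (h y y' h1 (by omega) (by omega)).symm⟩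
      · rintro ⟨y', hy', rfl⟩
        obtain ⟨y, hy, h1, h2, h3⟩ := cycleGraph_exists_adj_translate (x' := x)
          (by omega) (by omega) (by omega) (by omega) hy'
        exact ⟨y, hy, h y y' (by omega) (by omega) (by omega)⟩
    simp only [stateAfter, hid, hnb]
  | succ t ih =>
    have key2 : ∀ {y y' : Fin n}, y.val + x'.val = y'.val + x.val → y.val ≤ x.val + 1 →
        x.val ≤ y.val + 1 → A.stateAfter (SimpleGraph.cycleGraph n) ident t y =
        A.stateAfter (SimpleGraph.cycleGraph n) ident' t y' := fun {y y'} h1 h2 h3 => by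
      refine ih (by omega) (by omega) (by omega) (by omega) ?_
      exact fun z z' h4 h5 h6 => h z z' (by omega) (by omega) (by omega)
    have hst := key2 (y := x) (y' := x') (by omega) (by omega) (by omega)
    have hid : ident x = ident' x' := h x x' (by omega) (by omega) (by omega)
    have hin : A.inbox (SimpleGraph.cycleGraph n) ident
        (A.stateAfter (SimpleGraph.cycleGraph n) ident t) x =
        A.inbox (SimpleGraph.cycleGraph n) ident'
        (A.stateAfter (SimpleGraph.cycleGraph n) ident' t) x' := by
      ext e
      constructor
      · rintro ⟨y, hy, hh, rfl⟩
        obtain ⟨y', hy', h1, h2, h3⟩ := cycleGraph_exists_adj_translate (x' := x')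
          (by omega) (by omega) (by omega) (by omega) hy
        exact ⟨y', hy', key2 h1 h2 h3 ▸ hh,
          by rw [key2 h1 h2 h3, hid, h y y' h1 (by omega) (by omega)]⟩
      · rintro ⟨y', hy', hh, rfl⟩
        obtain ⟨y, hy, h1, h2, h3⟩ := cycleGraph_exists_adj_translate (x' := x)
          (by omega) (by omega) (by omega) (by omega) hy'
        have heq := key2 (y := y) (y' := y') (by omega) (by omega) (by omega)
        exact ⟨y, hy, heq.symm ▸ hh,
          by rw [heq, hid, h y y' (by omega) (by omega) (by omega)]⟩
    simp only [stateAfter, round]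
    rw [hst, hin]

/-- The assignment of identifiers to the vertices of a cycle in the order of the list `L`. -/
def identOf (n : ℕ) (L : List ℕ) : Fin n → ℕ := fun i => L.getD i 0

/-- A vertex whose neighborhood of radius `t + 1` carries the identifiers in `l` is selected. -/
def SelectsWindow (n t : ℕ) (l : List ℕ) : Prop :=
  ∃ (L : List ℕ) (p : ℕ) (h : p + (2 * t + 3) ≤ n), (L.drop p).take (2 * t + 3) = l ∧
    (⟨p + t + 1, by omega⟩ : Fin n) ∈ A.selected (SimpleGraph.cycleGraph n) (identOf n L) t

/-- By locality, the choice of `L` and `p` in `SelectsWindow` is immaterial. -/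
theorem selectsWindow_iff {n t : ℕ} (L : List ℕ) {p : ℕ} (h : p + (2 * t + 3) ≤ n) :
    A.SelectsWindow n t ((L.drop p).take (2 * t + 3)) ↔
      (⟨p + t + 1, by omega⟩ : Fin n) ∈
        A.selected (SimpleGraph.cycleGraph n) (identOf n L) t := by
  refine ⟨?_, fun hs => ⟨L, p, h, rfl, hs⟩⟩
  rintro ⟨L', p', h', heq, hs⟩
  unfold selected at hs ⊢
  rw [Set.mem_ofPred_eq] at hs ⊢
  rw [← hs]
  congr 1
  apply A.stateAfter_cycleGraph_congr t
  any_goals dsimp only; omega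
  intro y y' h1 h2 h3
  dsimp only at h1 h2 h3
  obtain ⟨d, hd⟩ := Nat.exists_eq_add_of_le (show p ≤ y.val by omega)
  have hd' : y'.val = p' + d := by omega
  have := congrArg (fun l : List ℕ => l.getD d 0) heq
  simp only [List.getD_eq_getElem?_getD, List.getElem?_take, List.getElem?_drop] at this
  rw [if_pos (by omega), if_pos (by omega)] at this
  simp only [identOf, hd, hd', List.getD_eq_getElem?_getD]
  exact this.symm

end LocalAlgorithm

/-! ### Identifier assignments with many selected vertices -/

theorem exists_append_perm_range {n : ℕ} {l : List ℕ} (hl : l.Nodup) (hn : ∀ e ∈ l, e < n) :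
    ∃ s : List ℕ, (l ++ s).Perm (List.range n) := by
  refine ⟨(List.range n).filter (· ∉ l), (List.perm_ext_iff_of_nodup ?_ List.nodup_range).2 ?_⟩
  · exact hl.append (List.nodup_range.filter _) fun e he he' => by simp_all
  · intro e
    have := hn e
    simp only [List.mem_append, List.mem_filter, List.mem_range, decide_eq_true_eq]
    tauto

namespace LocalAlgorithm

theorem identOf_lt {n : ℕ} {L : List ℕ} (hL : L.Perm (List.range n)) (i : Fin n) :
    identOf n L i < n := by
  have hlen : L.length = n := by simpa using hL.length_eq
  have := i.isLt
  rw [identOf, List.getD_eq_getElem _ _ (by omega), ← List.mem_range]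
  exact hL.mem_iff.1 (List.getElem_mem _)

theorem identOf_injective {n : ℕ} {L : List ℕ} (hL : L.Perm (List.range n)) :
    Function.Injective (identOf n L) := by
  intro i j hij
  have hlen : L.length = n := by simpa using hL.length_eq
  have := i.isLt
  have := j.isLt
  rw [identOf, identOf, List.getD_eq_getElem _ _ (by omega),
    List.getD_eq_getElem _ _ (by omega)] at hij
  exact Fin.ext ((hL.nodup_iff.2 List.nodup_range).getElem_inj_iff.1 hij)

end LocalAlgorithm

namespace LocalAlgorithm

variable (A : LocalAlgorithm.{u, v})

theorem not_isRun_not_selectsWindow {n t r : ℕ} {S : Finset ℕ} (hS : S ⊆ Finset.range n)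
    (hA : ∀ ident : Fin n → ℕ, Function.Injective ident → (∀ x, ident x < n) →
      IsDistDominating (SimpleGraph.cycleGraph n) r
        (A.selected (SimpleGraph.cycleGraph n) ident t)) (w : List ℕ) :
    ¬ IsRun S (2 * t + 2) (fun l => ¬ A.SelectsWindow n t l) (2 * r + 1) w := by
  intro hw
  obtain ⟨s, hs⟩ := exists_append_perm_range hw.nodup
    (fun e he => Finset.mem_range.1 (hS (hw.mem e he)))
  have hlen := hw.length_eq
  have hn : w.length ≤ n := by
    have := hs.length_eq
    rw [List.length_append, List.length_range] at this
    omega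
  have hdom := hA _ (identOf_injective hs) (identOf_lt hs)
  -- The windows are centred at `t + 1, …, 2r + t + 1`. This is the middle vertex, so any vertex
  -- dominating it is one of these centres.
  have hx : (⟨r + t + 1, by omega⟩ : Fin n) ∈ (Set.univ : Set (Fin n)) := Set.mem_univ _
  rw [← hdom] at hx
  obtain ⟨v, hv, hxv⟩ := Set.mem_iUnion₂.1 hx
  have hb := cycleGraph_val_bound_of_edist_le hxv (by dsimp only; omega) (by dsimp only; omega)
  dsimp only at hb
  obtain ⟨p, hp⟩ := Nat.exists_eq_add_of_le (show t + 1 ≤ v.val by omega)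
  refine hw.window p (by omega) ?_
  have hsel := A.selectsWindow_iff (n := n) (t := t) (w ++ s) (p := p) (by omega)
  rw [List.drop_append_of_le_length (by omega),
    List.take_append_of_le_length (by rw [List.length_drop]; omega)] at hsel
  refine hsel.2 ?_
  convert hv using 1
  exact Fin.ext (by dsimp only; omega)

theorem exists_ident_le_ncard_selected {n t r m : ℕ} (hm : 0 < m)
    (hA : ∀ ident : Fin n → ℕ, Function.Injective ident → (∀ x, ident x < n) →
      IsDistDominating (SimpleGraph.cycleGraph n) r
        (A.selected (SimpleGraph.cycleGraph n) ident t)) :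
    ∃ ident : Fin n → ℕ, Function.Injective ident ∧ (∀ x, ident x < n) ∧
      ∃ b, n ≤ expTower (2 * t + 1) ((m + 1) * (2 * r + 1 + 1)) + b * (m + (2 * t + 2)) ∧
        b * m ≤ (A.selected (SimpleGraph.cycleGraph n) ident t).ncard := by
  obtain ⟨b, l, hnd, hl, hlen, hcard, hP⟩ := exists_concat_runs (S := Finset.range n)
    (k := 2 * t + 2) (m := m) (B := expTower (2 * t + 1) ((m + 1) * (2 * r + 1 + 1)))
    (P := A.SelectsWindow n t) hm fun S' hS' hlt =>
      exists_isRun hlt (A.not_isRun_not_selectsWindow hS' hA)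
  rw [Finset.card_range] at hcard
  obtain ⟨s, hs⟩ := exists_append_perm_range hnd (fun e he => Finset.mem_range.1 (hl e he))
  have hn : l.length ≤ n := by
    have := hs.length_eq
    rw [List.length_append, List.length_range] at this
    omega
  refine ⟨identOf n (l ++ s), identOf_injective hs, identOf_lt hs, b, hcard, ?_⟩
  -- Window `i` of run `j` lies inside `l`; windows straddling two runs are not counted.
  have hpos : ∀ j < b, ∀ i < m, j * (m + (2 * t + 2)) + i + (2 * t + 3) ≤ l.length := by
    intro j hj i hi
    have : (j + 1) * (m + (2 * t + 2)) ≤ b * (m + (2 * t + 2)) := Nat.mul_le_mul_right _ hj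
    rw [Nat.add_mul] at this
    omega
  let f : Fin b × Fin m → Fin n := fun q =>
    ⟨q.1 * (m + (2 * t + 2)) + q.2 + t + 1, by
      have := hpos q.1 q.1.isLt q.2 q.2.isLt
      omega⟩
  have hf : Function.Injective f := by
    rintro ⟨j, i⟩ ⟨j', i'⟩ h
    have h1 : j.val * (m + (2 * t + 2)) + i.val = j'.val * (m + (2 * t + 2)) + i'.val := by
      have := congrArg Fin.val h
      simp only [f] at this
      omega
    have hdiv : ∀ (j : Fin b) (i : Fin m),
        (j.val * (m + (2 * t + 2)) + i.val) / (m + (2 * t + 2)) = j.val := fun j i => by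
      rw [mul_comm, Nat.mul_add_div (by omega), Nat.div_eq_of_lt (by omega), add_zero]
    have h2 : j.val = j'.val := by rw [← hdiv j i, ← hdiv j' i', h1]
    rw [h2] at h1
    exact Prod.ext (Fin.ext h2) (Fin.ext (by dsimp only; omega))
  calc b * m = (Set.range f).ncard := by
        rw [← Set.image_univ, Set.ncard_image_of_injective _ hf, Set.ncard_univ]
        simp
    _ ≤ _ := by
        refine Set.ncard_le_ncard ?_ (Set.toFinite _)
        rintro _ ⟨⟨j, i⟩, rfl⟩
        have hle := hpos j j.isLt i i.isLt
        have hsel := A.selectsWindow_iff (n := n) (t := t) (l ++ s)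
          (p := j * (m + (2 * t + 2)) + i) (by omega)
        rw [List.drop_append_of_le_length (by omega),
          List.take_append_of_le_length (by rw [List.length_drop]; omega)] at hsel
        exact hsel.1 (hP j j.isLt i i.isLt)

end LocalAlgorithm

/-! ### Counting and the final contradiction -/

/-- If most vertices are covered by `b` runs of `m` selected windows, then a good approximation of
a minimum dominating set is impossible on large cycles. -/
theorem card_bound_of_approx {δ : ℝ} (hδ : 0 < δ) {n r t Δ B b c D : ℕ} (hΔ : 1 ≤ δ * Δ)
    (hn : n ≤ B + b * ((2 * t + 2) * (2 * (2 * r + 1) * Δ) + (2 * t + 2)))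
    (hb : b * ((2 * t + 2) * (2 * (2 * r + 1) * Δ)) ≤ D)
    (hD : (D : ℝ) ≤ (2 * (r : ℝ) + 1 - δ) * c) (hc : c ≤ n / (2 * r + 1) + 1) :
    n ≤ (2 * (2 * r + 1) * Δ + 1) * (B + (2 * r + 1)) := by
  set R : ℝ := 2 * (r : ℝ) + 1 with hR
  have hR1 : (1 : ℝ) ≤ R := by have := r.cast_nonneg (α := ℝ); linarith
  have hn' : (n : ℝ) ≤ B + b * ((2 * t + 2) * (2 * R * Δ) + (2 * t + 2)) := by
    rw [hR]; exact_mod_cast hn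
  have hb' : (b : ℝ) * ((2 * t + 2) * (2 * R * Δ)) ≤ D := by
    rw [hR]; exact_mod_cast hb
  have hΔ0 : (0 : ℝ) < Δ := by
    by_contra h
    have : (Δ : ℝ) = 0 := le_antisymm (not_lt.1 h) Δ.cast_nonneg
    rw [this] at hΔ
    linarith
  -- Replacing `δ` by `min δ 1` keeps the factor `R - min δ 1` nonnegative.
  have hD2 : (D : ℝ) * R ≤ (R - min δ 1) * (n + R) := by
    have hc' : (c : ℝ) * R ≤ n + R := by
      have h1 : c * (2 * r + 1) ≤ n + (2 * r + 1) := by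
        calc c * (2 * r + 1) ≤ (n / (2 * r + 1) + 1) * (2 * r + 1) := Nat.mul_le_mul_right _ hc
          _ = n / (2 * r + 1) * (2 * r + 1) + (2 * r + 1) := by ring
          _ ≤ _ := Nat.add_le_add_right (Nat.div_mul_le_self _ _) _
      rw [hR]; exact_mod_cast h1
    have h2 : (D : ℝ) ≤ (R - min δ 1) * c :=
      hD.trans (mul_le_mul_of_nonneg_right (by linarith [min_le_left δ 1]) c.cast_nonneg)
    calc (D : ℝ) * R ≤ (R - min δ 1) * c * R := mul_le_mul_of_nonneg_right h2 (by linarith)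
      _ = (R - min δ 1) * (c * R) := by ring
      _ ≤ _ := mul_le_mul_of_nonneg_left hc' (by linarith [min_le_right δ 1])
  have hmin : 1 ≤ min δ 1 * Δ := by
    rcases min_cases δ 1 with ⟨h, -⟩ | ⟨h, -⟩
    · rwa [h]
    · rw [h, one_mul]
      exact_mod_cast (by exact_mod_cast hΔ0 : 0 < Δ)
  have hmin0 : 0 < min δ 1 := lt_min hδ one_pos
  generalize min δ 1 = ε at hD2 hmin hmin0
  set M : ℝ := 2 * R * Δ with hM
  have hM0 : 0 < M := by positivity
  have h3 : M * (n - B) ≤ (M + 1) * D := by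
    calc M * (n - B) ≤ M * (b * ((2 * t + 2) * M + (2 * t + 2))) :=
          mul_le_mul_of_nonneg_left (by linarith) hM0.le
      _ = (M + 1) * (b * ((2 * t + 2) * M)) := by ring
      _ ≤ _ := mul_le_mul_of_nonneg_left hb' (by linarith)
  have h4 : M * (n - B) * R ≤ (M + 1) * ((R - ε) * (n + R)) := by
    calc M * (n - B) * R ≤ (M + 1) * D * R := mul_le_mul_of_nonneg_right h3 (by linarith)
      _ = (M + 1) * (D * R) := by ring
      _ ≤ _ := mul_le_mul_of_nonneg_left hD2 (by linarith)
  -- One `R` pays for the loss from `M` to `M + 1`; the other leaves the term `n * R` of `h7`.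
  have h5 : 2 * R ≤ M * ε := by
    calc 2 * R = 2 * R * 1 := by ring
      _ ≤ 2 * R * (ε * Δ) := mul_le_mul_of_nonneg_left hmin (by linarith)
      _ = M * ε := by rw [hM]; ring
  have h6 : 2 * R * (n + R) ≤ (M + 1) * ε * (n + R) :=
    mul_le_mul_of_nonneg_right (by linarith) (by positivity)
  have h7 : (n : ℝ) * R ≤ ((M + 1) * (B + R)) * R := by
    have : 0 ≤ (B : ℝ) * R := by positivity
    nlinarith
  have h8 : (n : ℝ) ≤ (M + 1) * (B + R) := le_of_mul_le_mul_right h7 (by linarith)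
  rw [hM, hR] at h8
  exact_mod_cast h8

/-- Any bound linear in `t` and `r` suffices, so the exponent at the top of the tower is crudely
replaced by a tower of that height over `1`. -/
theorem logStar_le_of_le_mul {n r t Δ B : ℕ} (hΔ : 0 < Δ)
    (hB : B = expTower (2 * t + 1)
      (((2 * t + 2) * (2 * (2 * r + 1) * Δ) + 1) * (2 * r + 1 + 1)))
    (hn : n ≤ (2 * (2 * r + 1) * Δ + 1) * (B + (2 * r + 1))) :
    logStar n ≤ 4 * t + 4 * r + Δ + 9 := by
  have hq := le_expTower (2 * t + 1)
    (((2 * t + 2) * (2 * (2 * r + 1) * Δ) + 1) * (2 * r + 1 + 1))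
  rw [← hB] at hq
  have hM : 2 * (2 * r + 1) * Δ + 1 ≤ B := by
    refine le_trans ?_ hq
    nlinarith [Nat.zero_le (t * (r * Δ)), Nat.zero_le (t * Δ), Nat.zero_le (r * Δ),
      Nat.zero_le (t * (r * Δ) * r), Nat.zero_le (t * Δ * r), Nat.zero_le (r * Δ * r)]
  have hr : 2 * r + 1 ≤ B := by
    refine le_trans ?_ hq
    nlinarith [Nat.zero_le ((2 * t + 2) * (2 * (2 * r + 1) * Δ) * (2 * r + 1 + 1))]
  have hn2 : n ≤ 2 ^ 2 ^ B := by
    have hB1 : 1 ≤ B := by omega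
    have h1 : B ≤ 2 ^ (B - 1) := by
      have := Nat.lt_two_pow_self (n := B - 1)
      omega
    have h2 : 2 * B ≤ 2 ^ B := by
      calc 2 * B ≤ 2 * 2 ^ (B - 1) := by omega
        _ = 2 ^ B := by rw [← pow_succ', Nat.sub_add_cancel hB1]
    calc n ≤ B * (B + B) := hn.trans (Nat.mul_le_mul hM (by omega))
      _ ≤ 2 ^ B * 2 ^ B := Nat.mul_le_mul Nat.lt_two_pow_self.le (by omega)
      _ = 2 ^ (2 * B) := by rw [← pow_add, two_mul]
      _ ≤ _ := Nat.pow_le_pow_right two_pos h2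
  have hE : ((2 * t + 2) * (2 * (2 * r + 1) * Δ) + 1) * (2 * r + 1 + 1) ≤
      2 ^ (2 * t + 4 * r + Δ + 5) := by
    have h1 : (2 * t + 2) * (2 * (2 * r + 1) * Δ) + 1 ≤ 2 ^ (2 * t + 2 * r + Δ + 4) := by
      have h2 : 2 * t + 2 ≤ 2 ^ (2 * t + 2) := Nat.lt_two_pow_self.le
      have h3 : 2 * r + 1 ≤ 2 ^ (2 * r + 1) := Nat.lt_two_pow_self.le
      have h4 : Δ < 2 ^ Δ := Nat.lt_two_pow_self
      calc (2 * t + 2) * (2 * (2 * r + 1) * Δ) + 1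
          ≤ (2 * t + 2) * (2 * (2 * r + 1) * (Δ + 1)) := by nlinarith
        _ ≤ 2 ^ (2 * t + 2) * (2 * 2 ^ (2 * r + 1) * 2 ^ Δ) := by gcongr; exact h4
        _ = 2 ^ (2 * t + 2 * r + Δ + 4) := by ring
    have h2 : 2 * r + 1 + 1 ≤ 2 ^ (2 * r + 1) := Nat.lt_two_pow_self
    calc _ ≤ 2 ^ (2 * t + 2 * r + Δ + 4) * 2 ^ (2 * r + 1) := Nat.mul_le_mul h1 h2
      _ = _ := by ring
  refine logStar_le (hn2.trans ?_)
  have h3 := hE.trans (Nat.pow_le_pow_right two_pos (le_expTower_one _))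
  rw [← expTower_succ] at h3
  have h4 := expTower_mono (2 * t + 1) h3
  rw [← hB, ← expTower_add] at h4
  have e : 4 * t + 4 * r + Δ + 9 = (2 * t + 1 + (2 * t + 4 * r + Δ + 5 + 1)) + 1 + 1 := by omega
  rw [e, expTower_succ, expTower_succ]
  exact Nat.pow_le_pow_right two_pos (Nat.pow_le_pow_right two_pos h4)

theorem theorem2 (δ : ℝ) (hδ : 0 < δ) (r : ℕ → ℕ) (hr : ∀ n, 1 < r n)
    (hrlog : (fun n => (r n : ℝ)) =o[atTop] (fun n => (logStar n : ℝ))) :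
    ¬ ∃ (A : LocalAlgorithm.{u, v}) (T : ℕ → ℕ) (N : ℕ),
      (fun n => (T n : ℝ)) =O[atTop] (fun n => (r n : ℝ)) ∧
      ∀ n, N ≤ n → ∀ ident : Fin n → ℕ, Function.Injective ident → (∀ x, ident x < n) →
        A.FindsApproxDistDominating (SimpleGraph.cycleGraph n) ident (T n) (r n)
          (2 * (r n : ℝ) + 1 - δ) := by
  rintro ⟨A, T, N, hT, hA⟩
  obtain ⟨Δ, hΔ⟩ := exists_nat_ge (1 / δ)
  have hΔ1 : 1 ≤ δ * Δ := by rwa [div_le_iff₀' hδ] at hΔ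
  have hΔ0 : 0 < Δ := by
    rcases Nat.eq_zero_or_pos Δ with rfl | h
    · norm_num at hΔ1
    · exact h
  have key : ∀ n, N ≤ n → 0 < n → logStar n ≤ 4 * T n + 4 * r n + Δ + 9 := by
    intro n hN hn
    obtain ⟨ident, hinj, hlt, b, hb, hsel⟩ := A.exists_ident_le_ncard_selected
      (n := n) (t := T n) (r := r n) (m := (2 * T n + 2) * (2 * (2 * r n + 1) * Δ))
      (by positivity) fun ident hinj hlt => (hA n hN ident hinj hlt).2.1
    obtain ⟨M, hM, hMc⟩ := exists_isDistDominating_cycleGraph hn (r n)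
    obtain ⟨c, hc, hD⟩ := (hA n hN ident hinj hlt).2.ncard_le hM
    exact logStar_le_of_le_mul hΔ0 rfl
      (card_bound_of_approx hδ hΔ1 hb hsel hD (hc.trans hMc))
  obtain ⟨C, hC, hTC⟩ := hT.exists_pos
  have hK : 0 < 4 * C + 4 + Δ + 9 := by positivity
  -- Half the constant for which `log* n ≤ K * r n` is contradicted, where `K = 4 * C + 4 + Δ + 9`.
  have hε := hrlog.def (show 0 < 1 / (2 * (4 * C + 4 + Δ + 9)) by positivity)
  obtain ⟨n, hTn, hrn, hN, hn⟩ := (hTC.bound.and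
    (hε.and ((eventually_ge_atTop N).and (eventually_gt_atTop 0)))).exists
  rw [Real.norm_natCast, Real.norm_natCast] at hTn hrn
  have h1 : (logStar n : ℝ) ≤ 4 * T n + 4 * r n + Δ + 9 := by exact_mod_cast key n hN hn
  have h2 : (1 : ℝ) ≤ r n := by exact_mod_cast (hr n).le
  have h3 : (logStar n : ℝ) ≤ (4 * C + 4 + Δ + 9) * r n := by
    nlinarith [Δ.cast_nonneg (α := ℝ)]
  rw [div_mul_eq_mul_div, one_mul, le_div_iff₀ (by positivity)] at hrn
  nlinarith
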